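/- Throughout, for a topological group $G$, a $G$-flow is a continuous action of $G$ on a compact Hausdorff space $Z$; a subflow is a non-empty compact $G$-invariant subset of $Z$, and it is minimal if each of its $G$-orbits is dense in it. Let $\mathrm{Min}_G(Z)$ be the set of minimal subflows of $Z$, with the meets topology, that is, the topology generated by the sets $\{Y\in \mathrm{Min}_G(Z) : Y\cap A\neq\emptyset\}$ for $A\subseteq Z$ non-empty and open. The group $G$ has tractable minimal dynamics, written $G\in\mathsf{TMD}$, if for every $G$-flow $Z$ the space $\mathrm{Min}_G(Z)$ is compact and Hausdorff. Theorem. The class $\mathsf{TMD}$ is closed under group extensions: if $G$ is a topological group, $H\trianglelefteq G$ is a closed normal subgroup, and both $H\in\mathsf{TMD}$ and $G/H\in\mathsf{TMD}$ (with the subspace topology and the quotient topology), then $G\in\mathsf{TMD}$. -/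

import Mathlib

universe u

/-- The meets topology on the space `K(Z)` of non-empty compact subsets of `Z`: it is generated by
the sets `Meets(A, Z) = {K | K ∩ A ≠ ∅}` for `A ⊆ Z` non-empty and open. It is coarser than the
Vietoris topology and in general not Hausdorff. -/
abbrev meetsTopology (Z : Type*) [TopologicalSpace Z] :
    TopologicalSpace (TopologicalSpace.NonemptyCompacts Z) :=
  TopologicalSpace.generateFrom
    {S | ∃ A : Set Z, IsOpen A ∧ A.Nonempty ∧
      S = {K : TopologicalSpace.NonemptyCompacts Z | ((K : Set Z) ∩ A).Nonempty}}

/-- A subflow of a `G`-space `Z`: a non-empty, compact, `G`-invariant subset. -/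
def IsSubflow (G : Type*) [Group G] {Z : Type*} [TopologicalSpace Z] [MulAction G Z]
    (Y : TopologicalSpace.NonemptyCompacts Z) : Prop :=
  ∀ g : G, ∀ y ∈ Y, g • y ∈ Y

/-- A minimal subflow: a subflow in which every orbit is dense. -/
def IsMinimalSubflow (G : Type*) [Group G] {Z : Type*} [TopologicalSpace Z] [MulAction G Z]
    (Y : TopologicalSpace.NonemptyCompacts Z) : Prop :=
  IsSubflow G Y ∧ ∀ y ∈ Y, (Y : Set Z) ⊆ closure (MulAction.orbit G y)

/-- `Min_G(Z)`, the set of minimal subflows of `Z`. -/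
def MinSubflows (G : Type*) [Group G] (Z : Type*) [TopologicalSpace Z] [MulAction G Z] : Type _ :=
  {Y : TopologicalSpace.NonemptyCompacts Z // IsMinimalSubflow G Y}

/-- `Min_G(Z)` carries the subspace topology induced by the meets topology on `K(Z)`. -/
instance MinSubflows.instTopologicalSpace (G : Type*) [Group G] (Z : Type*) [TopologicalSpace Z] [MulAction G Z] :
    TopologicalSpace (MinSubflows G Z) :=
  TopologicalSpace.induced Subtype.val (meetsTopology Z)

/-- `G` has tractable minimal dynamics: for every `G`-flow `Z` (a continuous action of `G` on a
compact Hausdorff space), the meets topology on `Min_G(Z)` is compact Hausdorff. -/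
def TMD (G : Type u) [Group G] [TopologicalSpace G] : Prop :=
  ∀ (Z : Type u) [TopologicalSpace Z] [CompactSpace Z] [T2Space Z] [MulAction G Z]
    [ContinuousSMul G Z], CompactSpace (MinSubflows G Z) ∧ T2Space (MinSubflows G Z)

/-! Since `H` is normal, `G` permutes the minimal `H`-subflows of `Z`, and `H` fixes each of them,
so `Min_H(Z)`, compact Hausdorff by hypothesis, is a `G ⧸ H`-flow. Sending a minimal `G`-subflow `Y`
to the set of minimal `H`-subflows inside it gives a homeomorphism from `Min_G(Z)` onto `Min_{G ⧸
H}(Min_H(Z))`, which is compact Hausdorff by the second hypothesis. The link between the two levels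
is `exists_isOpen_mem_iff`, with its consequence `mem_of_mem_closure`. -/

open TopologicalSpace Set

namespace MinSubflows

section Basic

variable {G : Type*} [Group G] {Z : Type*} [TopologicalSpace Z] [MulAction G Z]

/-- The underlying set of a minimal subflow. -/
def carrier (Y : MinSubflows G Z) : Set Z := (Y.1 : Set Z)

theorem carrier_injective : Function.Injective (carrier : MinSubflows G Z → Set Z) :=
  fun _ _ h => Subtype.ext (SetLike.coe_injective h)

theorem nonempty_carrier (Y : MinSubflows G Z) : Y.carrier.Nonempty := Y.1.nonempty

theorem isCompact_carrier (Y : MinSubflows G Z) : IsCompact Y.carrier := Y.1.isCompact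

theorem smul_mem (Y : MinSubflows G Z) (g : G) {y : Z} (hy : y ∈ Y.carrier) :
    g • y ∈ Y.carrier := Y.2.1 g y hy

theorem subset_closure_orbit (Y : MinSubflows G Z) {y : Z} (hy : y ∈ Y.carrier) :
    Y.carrier ⊆ closure (MulAction.orbit G y) := Y.2.2 y hy

/-- Build a minimal subflow from its underlying set. -/
def ofSet (S : Set Z) (hc : IsCompact S) (hne : S.Nonempty) (hS : ∀ g : G, ∀ y ∈ S, g • y ∈ S)
    (hmin : ∀ y ∈ S, S ⊆ closure (MulAction.orbit G y)) : MinSubflows G Z :=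
  ⟨⟨⟨S, hc⟩, hne⟩, hS, hmin⟩

/-- A minimal subflow lies in every closed invariant set that it meets. -/
theorem carrier_subset_of_mem (Y : MinSubflows G Z) {S : Set Z} (hS : IsClosed S)
    (hinv : ∀ g : G, ∀ y ∈ S, g • y ∈ S) {y : Z} (hy : y ∈ Y.carrier) (hyS : y ∈ S) :
    Y.carrier ⊆ S :=
  (Y.subset_closure_orbit hy).trans
    (closure_minimal (by rintro _ ⟨g, rfl⟩; exact hinv g y hyS) hS)

theorem eq_of_mem [T2Space Z] {Y Y' : MinSubflows G Z} {y : Z} (hy : y ∈ Y.carrier)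
    (hy' : y ∈ Y'.carrier) : Y = Y' :=
  carrier_injective <| Subset.antisymm
    (Y.carrier_subset_of_mem Y'.isCompact_carrier.isClosed (fun g _ h => Y'.smul_mem g h) hy hy')
    (Y'.carrier_subset_of_mem Y.isCompact_carrier.isClosed (fun g _ h => Y.smul_mem g h) hy' hy)

/-- The minimal subflows that meet `A`. -/
def meets (A : Set Z) : Set (MinSubflows G Z) := {Y | (Y.carrier ∩ A).Nonempty}

theorem topology_eq_generateFrom : (instTopologicalSpace G Z) =
    generateFrom {S | ∃ A : Set Z, IsOpen A ∧ A.Nonempty ∧ S = meets A} := by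
  refine (induced_generateFrom_eq (α := MinSubflows G Z) (f := Subtype.val)).trans ?_
  congr 1
  ext S
  constructor
  · rintro ⟨_, ⟨A, hA, hne, rfl⟩, rfl⟩
    exact ⟨A, hA, hne, rfl⟩
  · rintro ⟨A, hA, hne, rfl⟩
    exact ⟨_, ⟨A, hA, hne, rfl⟩, rfl⟩

theorem isOpen_meets {A : Set Z} (hA : IsOpen A) : IsOpen (meets A : Set (MinSubflows G Z)) := by
  rcases A.eq_empty_or_nonempty with rfl | hne
  · have : (meets ∅ : Set (MinSubflows G Z)) = ∅ := by
      ext Y; simp [meets]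
    rw [this]
    exact isOpen_empty
  · rw [topology_eq_generateFrom]
    exact isOpen_generateFrom_of_mem ⟨A, hA, hne, rfl⟩

theorem continuous_of_isOpen_preimage_meets {X : Type*} [TopologicalSpace X]
    {f : X → MinSubflows G Z} (hf : ∀ A : Set Z, IsOpen A → IsOpen (f ⁻¹' meets A)) :
    Continuous f := by
  rw [topology_eq_generateFrom]
  refine continuous_generateFrom_iff.2 ?_
  rintro _ ⟨A, hA, -, rfl⟩
  exact hf A hA

theorem isClosed_setOf_carrier_subset {S : Set Z} (hS : IsClosed S) :
    IsClosed {Y : MinSubflows G Z | Y.carrier ⊆ S} := by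
  convert (isOpen_meets (G := G) hS.isOpen_compl).isClosed_compl using 1
  ext Y
  simp [meets, not_nonempty_iff_eq_empty, ← disjoint_iff_inter_eq_empty,
    disjoint_compl_right_iff_subset]

theorem exists_carrier_subset [CompactSpace Z] [ContinuousConstSMul G Z] {S : Set Z}
    (hS : IsClosed S) (hne : S.Nonempty) (hinv : ∀ g : G, ∀ y ∈ S, g • y ∈ S) :
    ∃ Y : MinSubflows G Z, Y.carrier ⊆ S := by
  let F : Set (Set Z) := {T | IsClosed T ∧ T.Nonempty ∧ ∀ g : G, ∀ y ∈ T, g • y ∈ T}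
  obtain ⟨T, hTS, hT⟩ := zorn_superset_nonempty F (fun c hcF hc hcne => by
    refine ⟨⋂₀ c, ⟨isClosed_sInter fun T hT => (hcF hT).1, ?_, ?_⟩,
      fun T hT => sInter_subset_of_mem hT⟩
    · have : Nonempty c := hcne.to_subtype
      exact IsCompact.nonempty_sInter_of_directed_nonempty_isCompact_isClosed
        (fun A hA B hB => (hc.total hA hB).elim (fun h => ⟨A, hA, Subset.rfl, h⟩)
          fun h => ⟨B, hB, h, Subset.rfl⟩)
        (fun T hT => (hcF hT).2.1) (fun T hT => (hcF hT).1.isCompact) (fun T hT => (hcF hT).1)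
    · exact fun g y hy T hT => (hcF hT).2.2 g y (hy T hT)) S ⟨hS, hne, hinv⟩
  refine ⟨ofSet T hT.1.1.isCompact hT.1.2.1 hT.1.2.2 fun y hy => ?_, hTS⟩
  refine hT.2 ⟨isClosed_closure, ⟨y, subset_closure (MulAction.mem_orbit_self y)⟩, fun g x hx => ?_⟩
    (closure_minimal (by rintro _ ⟨g, rfl⟩; exact hT.1.2.2 g y hy) hT.1.1)
  refine map_mem_closure (continuous_const_smul g) hx ?_
  rintro _ ⟨k, rfl⟩
  exact ⟨g * k, mul_smul g k y⟩

/-- The map sending a point of a minimal subflow to that subflow is continuous: membership of a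
minimal subflow in an open set can be read off, locally, from any of its points. -/
theorem exists_isOpen_mem_iff [T2Space Z] [ContinuousConstSMul G Z] {U : Set (MinSubflows G Z)}
    (hU : IsOpen U) :
    ∃ O : Set Z, IsOpen O ∧ ∀ L : MinSubflows G Z, ∀ x ∈ L.carrier, (L ∈ U ↔ x ∈ O) := by
  let X := {x : Z // ∃ L : MinSubflows G Z, x ∈ L.carrier}
  choose p hp using fun x : X => x.2
  have hcont : Continuous p := by
    refine continuous_of_isOpen_preimage_meets fun A hA => ?_
    -- The orbit of `x` is dense in `p x`, so `p x` meets `A` exactly when some translate of `x`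
    -- lies in `A`.
    have : p ⁻¹' meets A = ⋃ g : G, (fun x : X => g • (x : Z)) ⁻¹' A := by
      ext x
      simp only [mem_preimage, mem_iUnion]
      constructor
      · rintro ⟨y, hy, hyA⟩
        obtain ⟨_, hzA, g, rfl⟩ :=
          mem_closure_iff.1 ((p x).subset_closure_orbit (hp x) hy) A hA hyA
        exact ⟨g, hzA⟩
      · rintro ⟨g, hg⟩
        exact ⟨_, (p x).smul_mem g (hp x), hg⟩
    rw [this]
    exact isOpen_iUnion fun g =>
      hA.preimage ((continuous_const_smul g).comp continuous_subtype_val)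
  obtain ⟨O, hO, hOU⟩ := isOpen_induced_iff.1 (hU.preimage hcont)
  refine ⟨O, hO, fun L x hx => ?_⟩
  have h : (⟨x, L, hx⟩ : X) ∈ Subtype.val ⁻¹' O ↔ p ⟨x, L, hx⟩ ∈ U := by rw [hOU]; rfl
  rw [eq_of_mem hx (hp ⟨x, L, hx⟩)]
  exact h.symm

/-- Taking the closure of the union of a closed family adds no new minimal subflow: an open set of
`Z` detecting the complement of `C` contains `x` but misses the union. -/
theorem mem_of_mem_closure [T2Space Z] [ContinuousConstSMul G Z] {C : Set (MinSubflows G Z)}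
    (hC : IsClosed C) {L : MinSubflows G Z} {x : Z} (hx : x ∈ L.carrier)
    (hxC : x ∈ closure (⋃ M ∈ C, M.carrier)) : L ∈ C := by
  obtain ⟨O, hO, hOC⟩ := exists_isOpen_mem_iff hC.isOpen_compl
  by_contra hL
  obtain ⟨y, hyO, hy⟩ := mem_closure_iff.1 hxC O hO ((hOC L x hx).1 hL)
  obtain ⟨M, hM, hyM⟩ := mem_iUnion₂.1 hy
  exact (hOC M y hyM).2 hyO hM

end Basic

theorem exists_carrier_subset_carrier {G : Type*} [Group G] [TopologicalSpace G] (H : Subgroup G)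
    {Z : Type*} [TopologicalSpace Z] [CompactSpace Z] [T2Space Z] [MulAction G Z]
    [ContinuousSMul G Z]
    (Y : MinSubflows G Z) :
    ∃ L : MinSubflows H Z, L.carrier ⊆ Y.carrier :=
  exists_carrier_subset Y.isCompact_carrier.isClosed Y.nonempty_carrier
    fun h _ hy => Y.smul_mem (h : G) hy

section Normal

variable {G : Type*} [Group G] [TopologicalSpace G] (H : Subgroup G) [H.Normal]
  {Z : Type*} [TopologicalSpace Z] [MulAction G Z] [ContinuousSMul G Z]

/-- The translate of a minimal `H`-subflow by an element of a group in which `H` is normal. -/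
def translate (g : G) (L : MinSubflows H Z) : MinSubflows H Z :=
  ofSet ((g • ·) '' L.carrier) (L.isCompact_carrier.image (continuous_const_smul g))
    (L.nonempty_carrier.image _)
    (by
      rintro h _ ⟨y, hy, rfl⟩
      let k : H := ⟨g⁻¹ * h * g, by simpa using ‹H.Normal›.conj_mem h h.2 g⁻¹⟩
      refine ⟨k • y, L.smul_mem k hy, ?_⟩
      change g • (g⁻¹ * h * g) • y = (h : G) • g • y
      simp only [smul_smul]
      congr 1
      group)
    (by
      rintro _ ⟨y, hy, rfl⟩ _ ⟨x, hx, rfl⟩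
      refine map_mem_closure (continuous_const_smul g) (L.subset_closure_orbit hy hx) ?_
      rintro _ ⟨h, rfl⟩
      refine ⟨⟨g * h * g⁻¹, ‹H.Normal›.conj_mem h h.2 g⟩, ?_⟩
      change (g * h * g⁻¹) • g • y = g • (h : G) • y
      simp only [smul_smul]
      congr 1
      group)

instance instMulAction : MulAction G (MinSubflows H Z) where
  smul := translate H
  one_smul L := carrier_injective (by
    change ((1 : G) • ·) '' L.carrier = _
    simp)
  mul_smul g k L := carrier_injective (by
    change ((g * k) • ·) '' L.carrier = (g • ·) '' ((k • ·) '' L.carrier)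
    simp [image_image, mul_smul])

theorem smul_eq_self_of_mem {g : G} (hg : g ∈ H) (L : MinSubflows H Z) : g • L = L := by
  refine carrier_injective (Subset.antisymm ?_ fun y hy => ?_)
  · rintro _ ⟨y, hy, rfl⟩
    exact L.smul_mem (⟨g, hg⟩ : H) hy
  · exact ⟨g⁻¹ • y, L.smul_mem (⟨g⁻¹, H.inv_mem hg⟩ : H) hy, smul_inv_smul g y⟩

theorem continuous_smul_prod :
    Continuous fun p : G × MinSubflows H Z => p.1 • p.2 := by
  refine continuous_of_isOpen_preimage_meets fun A hA => isOpen_iff_mem_nhds.2 ?_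
  rintro ⟨g, L⟩ ⟨_, ⟨y, hy, rfl⟩, hgy⟩
  have hnhds : (fun q : G × Z => q.1 • q.2) ⁻¹' A ∈ nhds (g, y) :=
    (hA.preimage continuous_smul).mem_nhds hgy
  obtain ⟨V, U, hV, hgV, hU, hyU, hVU⟩ := mem_nhds_prod_iff'.1 hnhds
  refine Filter.mem_of_superset
    (prod_mem_nhds (hV.mem_nhds hgV) ((isOpen_meets hU).mem_nhds ⟨y, hy, hyU⟩)) ?_
  rintro ⟨k, M⟩ ⟨hk, x, hx, hxU⟩
  exact ⟨k • x, ⟨x, hx, rfl⟩, @hVU (k, x) ⟨hk, hxU⟩⟩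

instance instMulActionQuotient : MulAction (G ⧸ H) (MinSubflows H Z) :=
  MulAction.compHom _ (QuotientGroup.lift H (MulAction.toPermHom G (MinSubflows H Z))
    fun _ hg => Equiv.ext fun L => smul_eq_self_of_mem H hg L)

instance instContinuousSMulQuotient [IsTopologicalGroup G] :
    ContinuousSMul (G ⧸ H) (MinSubflows H Z) where
  continuous_smul := by
    -- Openness makes the product with the identity again a quotient map, so joint continuity
    -- descends from `G`.
    have hq : IsOpenQuotientMap
        (Prod.map ((↑) : G → G ⧸ H) (id : MinSubflows H Z → MinSubflows H Z)) :=
      QuotientGroup.isOpenQuotientMap_mk.prodMap IsOpenQuotientMap.id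
    exact hq.isQuotientMap.continuous_iff.2 (continuous_smul_prod H)

variable [CompactSpace Z] [T2Space Z]

/-- The minimal `H`-subflows inside a minimal `G`-subflow `Y` have dense union in `Y`. -/
theorem exists_mem_inter (Y : MinSubflows G Z) {O : Set Z} (hO : IsOpen O)
    (hYO : (Y.carrier ∩ O).Nonempty) :
    ∃ L : MinSubflows H Z, L.carrier ⊆ Y.carrier ∧ (L.carrier ∩ O).Nonempty := by
  obtain ⟨L, hL⟩ := exists_carrier_subset_carrier H Y
  obtain ⟨x, hx⟩ := L.nonempty_carrier
  obtain ⟨y, hy, hyO⟩ := hYO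
  obtain ⟨_, hgO, g, rfl⟩ := mem_closure_iff.1 (Y.subset_closure_orbit (hL hx) hy) O hO hyO
  refine ⟨g • L, ?_, _, ⟨x, hx, rfl⟩, hgO⟩
  rintro _ ⟨z, hz, rfl⟩
  exact Y.smul_mem g (hL hz)

variable [CompactSpace (MinSubflows H Z)]

/-- The minimal `G ⧸ H`-subflow of `Min_H(Z)` formed by the minimal `H`-subflows of a minimal
`G`-subflow of `Z`. -/
def toQuotient (Y : MinSubflows G Z) : MinSubflows (G ⧸ H) (MinSubflows H Z) :=
  ofSet {L | L.carrier ⊆ Y.carrier}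
    (isClosed_setOf_carrier_subset Y.isCompact_carrier.isClosed).isCompact
    (exists_carrier_subset_carrier H Y)
    (by
      rintro ⟨g⟩ L hL _ ⟨y, hy, rfl⟩
      exact Y.smul_mem g (hL hy))
    (by
      intro L hL M hM
      obtain ⟨x, hx⟩ := M.nonempty_carrier
      obtain ⟨y, hy⟩ := L.nonempty_carrier
      -- The union of the translates of `L` contains the `G`-orbit of `y`, which is dense in `Y`.
      refine mem_of_mem_closure isClosed_closure hx
        (closure_mono ?_ (Y.subset_closure_orbit (hL hy) (hM hx)))
      rintro _ ⟨g, rfl⟩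
      exact mem_iUnion₂.2 ⟨g • L, subset_closure ⟨(g : G ⧸ H), rfl⟩, y, hy, rfl⟩)

theorem toQuotient_injective :
    Function.Injective (toQuotient H : MinSubflows G Z → MinSubflows (G ⧸ H) _) := by
  intro Y Y' h
  obtain ⟨L, hL⟩ := exists_carrier_subset_carrier H Y
  obtain ⟨x, hx⟩ := L.nonempty_carrier
  have hL' : L ∈ (toQuotient H Y').carrier := h ▸ hL
  exact eq_of_mem (hL hx) (hL' hx)

/-- Any minimal `G`-subflow `Y` in the closure of the union of `C` works: a minimal `H`-subflow
inside `Y` belongs to `C`, and minimal `G ⧸ H`-subflows sharing a point coincide. -/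
theorem toQuotient_surjective [T2Space (MinSubflows H Z)] :
    Function.Surjective (toQuotient H : MinSubflows G Z → MinSubflows (G ⧸ H) _) := by
  intro C
  obtain ⟨L, hL⟩ := C.nonempty_carrier
  obtain ⟨x, hx⟩ := L.nonempty_carrier
  obtain ⟨Y, hY⟩ := exists_carrier_subset (G := G) (S := closure (⋃ M ∈ C.carrier, M.carrier))
    isClosed_closure ⟨x, subset_closure (mem_iUnion₂.2 ⟨L, hL, hx⟩)⟩ (by
      refine fun g y hy => map_mem_closure (continuous_const_smul g) hy fun z hz => ?_
      obtain ⟨M, hM, hzM⟩ := mem_iUnion₂.1 hz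
      exact mem_iUnion₂.2 ⟨g • M, C.smul_mem (g : G ⧸ H) hM, z, hzM, rfl⟩)
  refine ⟨Y, ?_⟩
  obtain ⟨N, hN⟩ := exists_carrier_subset_carrier H Y
  obtain ⟨z, hz⟩ := N.nonempty_carrier
  exact eq_of_mem (y := N) hN
    (mem_of_mem_closure C.isCompact_carrier.isClosed hz (hY (hN hz)))

/-- This gives continuity of the inverse, tested on subbasic open sets. -/
theorem toQuotient_preimage_meets_meets (A : Set Z) (hA : IsOpen A) :
    toQuotient H ⁻¹' meets (meets A) = (meets A : Set (MinSubflows G Z)) := by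
  ext Y
  constructor
  · rintro ⟨L, hL, x, hx, hxA⟩
    exact ⟨x, hL hx, hxA⟩
  · intro hY
    exact exists_mem_inter H Y hA hY

theorem continuous_toQuotient :
    Continuous (toQuotient H : MinSubflows G Z → MinSubflows (G ⧸ H) _) := by
  refine continuous_of_isOpen_preimage_meets fun U hU => ?_
  obtain ⟨O, hO, hOU⟩ := exists_isOpen_mem_iff hU
  convert isOpen_meets (G := G) hO using 1
  ext Y
  constructor
  · rintro ⟨L, hL, hLU⟩
    obtain ⟨x, hx⟩ := L.nonempty_carrier
    exact ⟨x, hL hx, (hOU L x hx).1 hLU⟩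
  · intro hY
    obtain ⟨L, hL, x, hx, hxO⟩ := exists_mem_inter H Y hO hY
    exact ⟨L, hL, (hOU L x hx).2 hxO⟩

/-- `Min_G(Z)` is homeomorphic to `Min_{G ⧸ H}(Min_H(Z))`. -/
noncomputable def homeomorphQuotient [T2Space (MinSubflows H Z)] :
    MinSubflows G Z ≃ₜ MinSubflows (G ⧸ H) (MinSubflows H Z) where
  toEquiv := Equiv.ofBijective (toQuotient H) ⟨toQuotient_injective H, toQuotient_surjective H⟩
  continuous_toFun := continuous_toQuotient H
  continuous_invFun := by
    refine continuous_of_isOpen_preimage_meets fun A hA => ?_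
    rw [← toQuotient_preimage_meets_meets H A hA, ← preimage_comp]
    convert isOpen_meets (G := G ⧸ H) (isOpen_meets (G := H) hA) using 1
    ext C
    exact iff_of_eq (congrArg (· ∈ meets (meets A))
      ((Equiv.ofBijective (toQuotient H)
        ⟨toQuotient_injective H, toQuotient_surjective H⟩).apply_symm_apply C))

end Normal

end MinSubflows

theorem theorem5p5 (G : Type u) [Group G] [TopologicalSpace G] [IsTopologicalGroup G]
    (H : Subgroup G) [H.Normal] (hH : IsClosed (H : Set G)) (hTH : TMD H) (hTK : TMD (G ⧸ H)) :
    TMD G := by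
  intro Z _ _ _ _ _
  obtain ⟨_, _⟩ := hTH Z
  obtain ⟨_, _⟩ := hTK (MinSubflows H Z)
  let e := MinSubflows.homeomorphQuotient (G := G) H (Z := Z)
  exact ⟨e.symm.compactSpace, e.symm.t2Space⟩
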